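/- Let $G$ be a Lie group, $H\subset G$ a closed subgroup, $M=G/H$ the homogeneous manifold with origin $p=eH$, $\pi:G\to G/H$ the canonical projection, and $\mathfrak g=\mathfrak m\oplus\mathfrak h$ a reductive decomposition of the Lie algebra $\mathfrak g$ of $G$: $\mathfrak h$ is the Lie algebra of $H$, $\mathfrak m$ is a vector space complement of $\mathfrak h$, and $\mathrm{Ad}(H)\mathfrak m\subset\mathfrak m$. Write $W_{\mathfrak m}$ for the component in $\mathfrak m$ of $W\in\mathfrak g$; a vector of $\mathfrak m$ is identified with its image under $d\pi_e$ in $T_pM$. Let $\tilde a$ be a smooth Riemannian metric on $M$ and $X$ a smooth vector field on $M$ with $\tilde a_x(X,X)<1$ for all $x\in M$, and suppose that the Randers metric $$F(x,v)=\sqrt{\tilde a_x(v,v)}+\tilde a_x(X,v),\qquad x\in M,\ v\in T_xM,$$ is $G$-invariant, so that $(M,F)$ is a homogeneous Randers space. A vector $y\in\mathfrak g$ is called a geodesic vector of $(M,F)$ (respectively of $(M,\tilde a)$) if $y\neq 0$ and the curve $\gamma(t)=\exp(ty)\cdot p$, $t\in\mathbb R$, is a constant speed geodesic of $F$ (respectively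 of $\tilde a$, that is, of the function $\sqrt{\tilde a(v,v)}$). Here a constant speed geodesic of a function $L$ on $TM$ is a smooth curve along which $L(\gamma,\dot\gamma)$ is constant and which, wherever $\dot\gamma\ne0$, satisfies the Euler–Lagrange equations $\frac{d}{dt}\frac{\partial L}{\partial\dot x^i}-\frac{\partial L}{\partial x^i}=0$ in local coordinates; constant curves count as geodesics. **Theorem.** Let $y\in\mathfrak g$ be such that $\tilde a_p(X_p,[y,z]_{\mathfrak m})=0$ for all $z\in\mathfrak m$. Then $y$ is a geodesic vector of $(M,F)$ if and only if $y$ is a geodesic vector of $(M,\tilde a)$. -/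

import Mathlib

open scoped Manifold ContDiff

noncomputable section

namespace HomogeneousRanders

/-! ### Geodesics of a Finsler function -/

section Geodesics

variable {E : Type*} [NormedAddCommGroup E] [NormedSpace ℝ E]
  {M : Type*} [TopologicalSpace M] [ChartedSpace E M]

/-- The velocity vector `γ'(t)` of a curve in `M`. -/
def velocity (γ : ℝ → M) (t : ℝ) : TangentSpace 𝓘(ℝ, E) (γ t) :=
  mfderiv 𝓘(ℝ, ℝ) 𝓘(ℝ, E) γ t (1 : ℝ)

/-- The function `F` on `TM` in the coordinates given by the chart `φ`: its value `F (x, v)` at the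
point with coordinates `x` and the tangent vector `∑ vⁱ ∂/∂xⁱ` at that point. -/
def inChart (F : (x : M) → TangentSpace 𝓘(ℝ, E) x → ℝ) (φ : OpenPartialHomeomorph M E)
    (x v : E) : ℝ :=
  F (φ.symm x) (mfderiv 𝓘(ℝ, E) 𝓘(ℝ, E) φ.symm x v)

/-- The Euler-Lagrange equations `d/dt (∂F/∂ẋⁱ) - ∂F/∂xⁱ = 0` of `F` hold along `γ` at time `t`,
in the coordinates given by the chart `φ`. (The partial differentials in `ẋ` and in `x` are written
without indices, as linear forms on the model space.) -/
def EulerLagrangeAt (F : (x : M) → TangentSpace 𝓘(ℝ, E) x → ℝ) (φ : OpenPartialHomeomorph M E)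
    (γ : ℝ → M) (t : ℝ) : Prop :=
  HasDerivAt
    (fun s : ℝ ↦ fderiv ℝ (fun v : E ↦ inChart F φ (φ (γ s)) v) (deriv (fun r ↦ φ (γ r)) s))
    (fderiv ℝ (fun x : E ↦ inChart F φ x (deriv (fun r ↦ φ (γ r)) t)) (φ (γ t)))
    t

/-- `γ : ℝ → M` is a constant speed geodesic of `F`: it is smooth, `F(γ')` is constant, and the
Euler-Lagrange equations of the length functional `∫ F(γ, γ') dt` hold in all (smooth) local
coordinates. As `F` is not differentiable at zero vectors, the equations are required where the
velocity does not vanish; for a Finsler metric `F` the speed is constant, so that this leaves out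
nothing but the constant curves, which count as (degenerate) geodesics of speed `0`. -/
structure IsConstantSpeedGeodesic (F : (x : M) → TangentSpace 𝓘(ℝ, E) x → ℝ) (γ : ℝ → M) :
    Prop where
  smooth : ContMDiff 𝓘(ℝ, ℝ) 𝓘(ℝ, E) ∞ γ
  constant_speed : ∃ c : ℝ, ∀ t : ℝ, F (γ t) (velocity (E := E) γ t) = c
  euler_lagrange : ∀ t : ℝ, velocity (E := E) γ t ≠ 0 →
    ∀ φ ∈ IsManifold.maximalAtlas 𝓘(ℝ, E) ∞ M, γ t ∈ φ.source → EulerLagrangeAt F φ γ t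

variable [IsManifold 𝓘(ℝ, E) ∞ M]

/-- The norm `α(x, v) = √(a_x(v, v))` of a Riemannian metric `a`. -/
def riemannianNorm
    (a : Bundle.ContMDiffRiemannianMetric 𝓘(ℝ, E) ∞ E (fun x : M ↦ TangentSpace 𝓘(ℝ, E) x))
    (x : M) (v : TangentSpace 𝓘(ℝ, E) x) : ℝ :=
  √(a.inner x v v)

/-- The Randers function `F(x, v) = √(a_x(v, v)) + a_x(X, v)` of a Riemannian metric `a` and a
vector field `X`. -/
def randersNorm
    (a : Bundle.ContMDiffRiemannianMetric 𝓘(ℝ, E) ∞ E (fun x : M ↦ TangentSpace 𝓘(ℝ, E) x))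
    (X : (x : M) → TangentSpace 𝓘(ℝ, E) x) (x : M) (v : TangentSpace 𝓘(ℝ, E) x) : ℝ :=
  √(a.inner x v v) + a.inner x (X x) v

end Geodesics

/-! ### Lie groups and homogeneous spaces

`G` is a Lie group with Lie algebra `GroupLieAlgebra 𝓘(ℝ, E') G` (the tangent space at `1`), and `H`
is a subgroup of `G`. -/

section Homogeneous

variable {E' : Type*} [NormedAddCommGroup E'] [NormedSpace ℝ E']
  {G : Type*} [TopologicalSpace G] [ChartedSpace E' G] [Group G]

/-- `c` is the one-parameter subgroup `t ↦ exp (t Y)` of `G`: the smooth homomorphism `ℝ → G` with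
`c'(0) = Y`. -/
structure IsOneParameterSubgroup (Y : GroupLieAlgebra 𝓘(ℝ, E') G) (c : ℝ → G) : Prop where
  smooth : ContMDiff 𝓘(ℝ, ℝ) 𝓘(ℝ, E') ∞ c
  map_add : ∀ s t : ℝ, c (s + t) = c s * c t
  velocity_zero : velocity (E := E') c 0 = Y

/-- The adjoint representation: `Ad g` is the differential at `1` of `k ↦ g k g⁻¹`. -/
def Ad (g : G) : GroupLieAlgebra 𝓘(ℝ, E') G →L[ℝ] GroupLieAlgebra 𝓘(ℝ, E') G :=
  mfderiv 𝓘(ℝ, E') 𝓘(ℝ, E') (fun k : G ↦ g * k * g⁻¹) (1 : G)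

/-- `𝔤 = m ⊕ h` is a reductive decomposition with respect to `H`: `h` is the Lie algebra of `H`,
that is, the set of all `Y` such that `exp (t Y) ∈ H` for all `t`, `m` is a vector space complement
of `h`, and `Ad(H) m ⊆ m`. -/
structure IsReductiveDecomposition (H : Subgroup G)
    (m h : Submodule ℝ (GroupLieAlgebra 𝓘(ℝ, E') G)) : Prop where
  mem_h : ∀ Y, Y ∈ h ↔ ∃ c : ℝ → G, IsOneParameterSubgroup Y c ∧ ∀ t, c t ∈ H
  isCompl : IsCompl m h
  ad_mem : ∀ k ∈ H, ∀ Y ∈ m, Ad k Y ∈ m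

variable {E : Type*} [NormedAddCommGroup E] [NormedSpace ℝ E]

/-- The manifold structure of `G ⧸ H` is the one of the homogeneous manifold `G/H`, that is, the
(unique) smooth structure for which the canonical projection `G → G/H` is a smooth submersion. -/
def IsHomogeneousManifold (E' E : Type*) [NormedAddCommGroup E'] [NormedSpace ℝ E']
    [NormedAddCommGroup E] [NormedSpace ℝ E]
    {G : Type*} [TopologicalSpace G] [ChartedSpace E' G] [Group G] (H : Subgroup G)
    [ChartedSpace E (G ⧸ H)] : Prop :=
  Manifold.IsSubmersion 𝓘(ℝ, E') 𝓘(ℝ, E) ∞ (QuotientGroup.mk : G → G ⧸ H)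

variable (H : Subgroup G) [ChartedSpace E (G ⧸ H)]

/-- The origin `p = eH` of `G/H`. -/
def origin : G ⧸ H := QuotientGroup.mk (1 : G)

/-- The differential at `1` of the canonical projection `G → G/H`, a linear map from the Lie algebra
to the tangent space of `G/H` at the origin. -/
def projDeriv : GroupLieAlgebra 𝓘(ℝ, E') G →L[ℝ] TangentSpace 𝓘(ℝ, E) (origin H) :=
  mfderiv 𝓘(ℝ, E') 𝓘(ℝ, E) (QuotientGroup.mk : G → G ⧸ H) (1 : G)

/-- `F` is `G`-invariant: every `g : G` acts on `G/H` as an isometry of `F`. -/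
def IsInvariant (F : (x : G ⧸ H) → TangentSpace 𝓘(ℝ, E) x → ℝ) : Prop :=
  ∀ (g : G) (x : G ⧸ H) (v : TangentSpace 𝓘(ℝ, E) x),
    F (g • x) (mfderiv 𝓘(ℝ, E) 𝓘(ℝ, E) (fun q : G ⧸ H ↦ g • q) x v) = F x v

/-- `Y` is a geodesic vector of `(G/H, F)`: it is nonzero, and the orbit `t ↦ exp (t Y) p` of the
origin `p` is a constant speed geodesic of `F`. -/
def IsGeodesicVector (F : (x : G ⧸ H) → TangentSpace 𝓘(ℝ, E) x → ℝ)
    (Y : GroupLieAlgebra 𝓘(ℝ, E') G) : Prop :=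
  Y ≠ 0 ∧ ∃ c : ℝ → G, IsOneParameterSubgroup Y c ∧
    IsConstantSpeedGeodesic F (fun t : ℝ ↦ c t • origin H)

end Homogeneous

end HomogeneousRanders

end

open scoped Topology

namespace HomogeneousRanders

section Charts

variable {E : Type*} [NormedAddCommGroup E] [NormedSpace ℝ E]
  {M : Type*} [TopologicalSpace M] [ChartedSpace E M]
  {E₀ : Type*} [NormedAddCommGroup E₀] [NormedSpace ℝ E₀]
  {φ : OpenPartialHomeomorph M E}

/-- A function on the tangent bundle takes equal values at equal points and vectors, where the
tangent spaces are identified with the model space. -/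
theorem apply_congr_point (F : (x : M) → TangentSpace 𝓘(ℝ, E) x → ℝ) {p q : M} (hpq : p = q)
    {v w : E} (hvw : v = w) :
    F p (show TangentSpace 𝓘(ℝ, E) p from v) = F q (show TangentSpace 𝓘(ℝ, E) q from w) := by
  subst hpq hvw
  rfl

theorem mdifferentiable_of_mem_maximalAtlas
    (hφ : φ ∈ IsManifold.maximalAtlas 𝓘(ℝ, E) ∞ M) :
    φ.MDifferentiable 𝓘(ℝ, E) 𝓘(ℝ, E) :=
  ⟨(contMDiffOn_of_mem_maximalAtlas hφ).mdifferentiableOn (by simp),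
    (contMDiffOn_symm_of_mem_maximalAtlas hφ).mdifferentiableOn (by simp)⟩

theorem fderiv_chart_comp (hφ : φ ∈ IsManifold.maximalAtlas 𝓘(ℝ, E) ∞ M) {f : E₀ → M} {x : E₀}
    (hf : MDifferentiableAt 𝓘(ℝ, E₀) 𝓘(ℝ, E) f x) (hx : f x ∈ φ.source) (v : E₀) :
    fderiv ℝ (fun z ↦ φ (f z)) x v =
      mfderiv 𝓘(ℝ, E) 𝓘(ℝ, E) φ (f x) (mfderiv 𝓘(ℝ, E₀) 𝓘(ℝ, E) f x v) := by
  rw [← mfderiv_eq_fderiv]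
  exact mfderiv_comp_apply x ((mdifferentiable_of_mem_maximalAtlas hφ).mdifferentiableAt hx) hf v

theorem inChart_fderiv_chart_comp (F : (x : M) → TangentSpace 𝓘(ℝ, E) x → ℝ)
    (hφ : φ ∈ IsManifold.maximalAtlas 𝓘(ℝ, E) ∞ M) {f : E₀ → M} {x : E₀}
    (hf : MDifferentiableAt 𝓘(ℝ, E₀) 𝓘(ℝ, E) f x) (hx : f x ∈ φ.source) (v : E₀) :
    inChart F φ (φ (f x)) (fderiv ℝ (fun z ↦ φ (f z)) x v) =
      F (f x) (mfderiv 𝓘(ℝ, E₀) 𝓘(ℝ, E) f x v) := by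
  have h := (mdifferentiable_of_mem_maximalAtlas hφ).symm_comp_deriv hx
  have h' : ∀ w : TangentSpace 𝓘(ℝ, E) (f x), mfderiv 𝓘(ℝ, E) 𝓘(ℝ, E) φ.symm (φ (f x))
      (mfderiv 𝓘(ℝ, E) 𝓘(ℝ, E) φ (f x) w) = w := fun w ↦ DFunLike.congr_fun h w
  rw [fderiv_chart_comp hφ hf hx]
  exact apply_congr_point F (φ.left_inv hx) (h' _)

/-- The coordinate vector field with constant components `v` of a chart, as a field along the
inverse of the chart, is differentiable. -/
theorem mdifferentiableAt_mfderiv_symm_apply [IsManifold 𝓘(ℝ, E) ∞ M]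
    (hφ : φ ∈ IsManifold.maximalAtlas 𝓘(ℝ, E) ∞ M) {x : E} (hx : x ∈ φ.target) (v : E) :
    MDifferentiableAt 𝓘(ℝ, E) 𝓘(ℝ, E).tangent
      (fun z ↦ (⟨φ.symm z, mfderiv 𝓘(ℝ, E) 𝓘(ℝ, E) φ.symm z v⟩ : TangentBundle 𝓘(ℝ, E) M)) x := by
  have hs : UniqueMDiffOn 𝓘(ℝ, E) φ.target := φ.open_target.uniqueMDiffOn
  have h := (contMDiffOn_symm_of_mem_maximalAtlas hφ).contMDiffOn_tangentMapWithin
    (m := 1) (by decide) hs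
  have hc : ContMDiff 𝓘(ℝ, E) 𝓘(ℝ, E).tangent 1
      (fun z : E ↦ (⟨z, v⟩ : TangentBundle 𝓘(ℝ, E) E)) := by
    exact contMDiff_vectorSpace_iff_contDiff (V := fun _ ↦ v).2 contDiff_const
  have h1 := (h.comp hc.contMDiffOn (s := φ.target) (fun z hz ↦ hz)).contMDiffAt
    (φ.open_target.mem_nhds hx)
  refine (h1.mdifferentiableAt one_ne_zero).congr_of_eventuallyEq ?_
  filter_upwards [φ.open_target.mem_nhds hx] with z hz
  simp only [Function.comp, tangentMapWithin]
  rw [mfderivWithin_of_mem_nhds (φ.open_target.mem_nhds hz)]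

theorem differentiableAt_inner_comp [IsManifold 𝓘(ℝ, E) ∞ M]
    (a : Bundle.ContMDiffRiemannianMetric 𝓘(ℝ, E) ∞ E (fun x : M ↦ TangentSpace 𝓘(ℝ, E) x))
    {f : E₀ → M} {U W : (z : E₀) → TangentSpace 𝓘(ℝ, E) (f z)} {x : E₀}
    (hU : MDifferentiableAt 𝓘(ℝ, E₀) 𝓘(ℝ, E).tangent
      (fun z ↦ (⟨f z, U z⟩ : TangentBundle 𝓘(ℝ, E) M)) x)
    (hW : MDifferentiableAt 𝓘(ℝ, E₀) 𝓘(ℝ, E).tangent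
      (fun z ↦ (⟨f z, W z⟩ : TangentBundle 𝓘(ℝ, E) M)) x) :
    DifferentiableAt ℝ (fun z ↦ a.inner (f z) (U z) (W z)) x := by
  have hb : MDifferentiableAt 𝓘(ℝ, E₀) 𝓘(ℝ, E) f x := by
    simp only [mdifferentiableAt_totalSpace] at hU
    exact hU.1
  have : MDifferentiableAt 𝓘(ℝ, E₀) (𝓘(ℝ, E).prod 𝓘(ℝ)) (fun z ↦ Bundle.TotalSpace.mk' ℝ
      (E := Bundle.Trivial M ℝ) (f z) (a.inner (f z) (U z) (W z))) x := by
    apply MDifferentiableAt.clm_bundle_apply₂ (F₁ := E) (F₂ := E)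
    · exact (a.contMDiff.mdifferentiableAt (by simp)).comp x hb
    · exact hU
    · exact hW
  simp only [mdifferentiableAt_totalSpace] at this
  exact mdifferentiableAt_iff_differentiableAt.1 this.2

end Charts

section Calculus

variable {E E₀ : Type*} [NormedAddCommGroup E] [NormedSpace ℝ E]
  [NormedAddCommGroup E₀] [NormedSpace ℝ E₀]

/-- The formula `dB(V, W) = V (B W) - W (B V) - B [V, W]` for the pullback under `P` of a one-form
`B`, in the case where `B V` and `B W` are constant. -/
theorem fderiv_apply_sub_fderiv_apply {B : E → E →L[ℝ] ℝ} {P : E₀ → E} {V W : E₀ → E₀} {x : E₀}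
    (hB : DifferentiableAt ℝ B (P x)) (hP : ContDiffAt ℝ 2 P x)
    (hV : DifferentiableAt ℝ V x) (hW : DifferentiableAt ℝ W x) {k l : ℝ}
    (hk : ∀ᶠ z in 𝓝 x, B (P z) (fderiv ℝ P z (V z)) = k)
    (hl : ∀ᶠ z in 𝓝 x, B (P z) (fderiv ℝ P z (W z)) = l) :
    fderiv ℝ B (P x) (fderiv ℝ P x (V x)) (fderiv ℝ P x (W x)) -
      fderiv ℝ B (P x) (fderiv ℝ P x (W x)) (fderiv ℝ P x (V x)) =
        - B (P x) (fderiv ℝ P x (VectorField.lieBracket ℝ V W x)) := by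
  have hP1 : DifferentiableAt ℝ P x := hP.differentiableAt (by simp)
  have hP2 : DifferentiableAt ℝ (fderiv ℝ P) x :=
    (hP.fderiv_right (m := 1) (by norm_num)).differentiableAt (by simp)
  have key : ∀ {U : E₀ → E₀} {c : ℝ}, DifferentiableAt ℝ U x →
      (∀ᶠ z in 𝓝 x, B (P z) (fderiv ℝ P z (U z)) = c) → ∀ u : E₀,
      fderiv ℝ B (P x) (fderiv ℝ P x u) (fderiv ℝ P x (U x)) +
        B (P x) (fderiv ℝ (fderiv ℝ P) x u (U x) + fderiv ℝ P x (fderiv ℝ U x u)) = 0 := by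
    intro U c hU hc u
    have h1 : HasFDerivAt (fun z ↦ B (P z) (fderiv ℝ P z (U z))) _ x :=
      (hB.hasFDerivAt.comp x hP1.hasFDerivAt).clm_apply
        (hP2.hasFDerivAt.clm_apply hU.hasFDerivAt)
    have h2 := h1.unique ((hasFDerivAt_const c x).congr_of_eventuallyEq hc)
    have h3 := DFunLike.congr_fun h2 u
    simp at h3
    rw [map_add]
    linarith
  have hV' := key hV hk (W x)
  have hW' := key hW hl (V x)
  have hsymm := (hP.isSymmSndFDerivAt (by simp)).eq (V x) (W x)
  rw [VectorField.lieBracket]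
  simp only [map_add, map_sub] at hV' hW' ⊢
  rw [hsymm] at hW'
  linarith

end Calculus

theorem differentiableAt_of_forall_apply {E E₀ : Type*} [NormedAddCommGroup E] [NormedSpace ℝ E]
    [FiniteDimensional ℝ E] [NormedAddCommGroup E₀] [NormedSpace ℝ E₀] {B : E₀ → E →L[ℝ] ℝ} {x : E₀}
    (h : ∀ v, DifferentiableAt ℝ (fun z ↦ B z v) x) : DifferentiableAt ℝ B x := by
  let b := Module.finBasis ℝ E
  have hB : B = fun z ↦ ∑ i, B z (b i) • LinearMap.toContinuousLinearMap (b.coord i) := by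
    ext z v
    have h := congrArg (B z) (b.sum_repr v)
    rw [map_sum] at h
    simpa [mul_comm] using h.symm
  rw [hB]
  exact DifferentiableAt.fun_sum fun i _ ↦ (h (b i)).smul_const _

section Randers

variable {E : Type*} [NormedAddCommGroup E] [NormedSpace ℝ E]
  {M : Type*} [TopologicalSpace M] [ChartedSpace E M] [IsManifold 𝓘(ℝ, E) ∞ M]
  (a : Bundle.ContMDiffRiemannianMetric 𝓘(ℝ, E) ∞ E (fun x : M ↦ TangentSpace 𝓘(ℝ, E) x))
  {X : (x : M) → TangentSpace 𝓘(ℝ, E) x} {φ : OpenPartialHomeomorph M E}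

theorem riemannianNorm_eq_zero_iff {x : M} {v : TangentSpace 𝓘(ℝ, E) x} :
    riemannianNorm a x v = 0 ↔ v = 0 := by
  constructor
  · intro h
    by_contra hv
    exact (Real.sqrt_pos.2 (a.pos x v hv)).ne' h
  · rintro rfl
    simp [riemannianNorm]

/-- The one-form `a(X, ·)` in the coordinates given by the chart `φ`. -/
noncomputable def formInChart (X : (x : M) → TangentSpace 𝓘(ℝ, E) x)
    (φ : OpenPartialHomeomorph M E) (x : E) : E →L[ℝ] ℝ :=
  (a.inner (φ.symm x) (X (φ.symm x))).comp (mfderiv 𝓘(ℝ, E) 𝓘(ℝ, E) φ.symm x)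

theorem inChart_randersNorm (x v : E) :
    inChart (randersNorm a X) φ x v = inChart (riemannianNorm a) φ x v + formInChart a X φ x v :=
  rfl

theorem differentiableAt_formInChart [FiniteDimensional ℝ E]
    (hX : ContMDiff 𝓘(ℝ, E) 𝓘(ℝ, E).tangent ∞ (fun x ↦ (⟨x, X x⟩ : TangentBundle 𝓘(ℝ, E) M)))
    (hφ : φ ∈ IsManifold.maximalAtlas 𝓘(ℝ, E) ∞ M) {x : E} (hx : x ∈ φ.target) :
    DifferentiableAt ℝ (formInChart a X φ) x := by
  refine differentiableAt_of_forall_apply fun v ↦ ?_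
  refine differentiableAt_inner_comp a (f := φ.symm) (U := fun z ↦ X (φ.symm z))
    (W := fun z ↦ mfderiv 𝓘(ℝ, E) 𝓘(ℝ, E) φ.symm z v) ?_
    (mdifferentiableAt_mfderiv_symm_apply hφ hx v)
  exact (hX.mdifferentiableAt (by simp)).comp x
    ((mdifferentiable_of_mem_maximalAtlas hφ).mdifferentiableAt_symm hx)

theorem differentiableAt_inChart_riemannianNorm_left
    (hφ : φ ∈ IsManifold.maximalAtlas 𝓘(ℝ, E) ∞ M) {x v : E} (hx : x ∈ φ.target)
    (h : inChart (riemannianNorm a) φ x v ≠ 0) :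
    DifferentiableAt ℝ (fun z ↦ inChart (riemannianNorm a) φ z v) x := by
  have hv := mdifferentiableAt_mfderiv_symm_apply hφ hx v
  refine (differentiableAt_inner_comp a (f := φ.symm) hv hv).sqrt ?_
  intro h0
  exact h ((congrArg Real.sqrt h0).trans Real.sqrt_zero)

theorem differentiableAt_inChart_riemannianNorm_right {x v : E}
    (h : inChart (riemannianNorm a) φ x v ≠ 0) :
    DifferentiableAt ℝ (fun w ↦ inChart (riemannianNorm a) φ x w) v := by
  let A : E →L[ℝ] E := mfderiv 𝓘(ℝ, E) 𝓘(ℝ, E) φ.symm x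
  let b : E →L[ℝ] E →L[ℝ] ℝ := a.inner (φ.symm x)
  have hd : DifferentiableAt ℝ (fun w : E ↦ b (A w) (A w)) v := by fun_prop
  refine hd.sqrt ?_
  intro h0
  exact h ((congrArg Real.sqrt h0).trans Real.sqrt_zero)

/-- If the Euler-Lagrange equations of the one-form `a(X, ·)` hold along a regular curve, then those
of the Randers function are equivalent to those of the Riemannian norm. -/
theorem eulerLagrangeAt_randersNorm_iff [FiniteDimensional ℝ E]
    (hX : ContMDiff 𝓘(ℝ, E) 𝓘(ℝ, E).tangent ∞ (fun x ↦ (⟨x, X x⟩ : TangentBundle 𝓘(ℝ, E) M)))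
    (hφ : φ ∈ IsManifold.maximalAtlas 𝓘(ℝ, E) ∞ M) {γ : ℝ → M}
    (hγ : ContMDiff 𝓘(ℝ, ℝ) 𝓘(ℝ, E) ∞ γ) (hv : ∀ t, velocity (E := E) γ t ≠ 0) {t : ℝ}
    (ht : γ t ∈ φ.source)
    (hform : HasDerivAt (fun s ↦ formInChart a X φ (φ (γ s)))
      (fderiv ℝ (fun x ↦ formInChart a X φ x (deriv (fun r ↦ φ (γ r)) t)) (φ (γ t))) t) :
    EulerLagrangeAt (randersNorm a X) φ γ t ↔ EulerLagrangeAt (riemannianNorm a) φ γ t := by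
  have hne : ∀ s, γ s ∈ φ.source →
      inChart (riemannianNorm a) φ (φ (γ s)) (deriv (fun r ↦ φ (γ r)) s) ≠ 0 := by
    intro s hs
    have h := inChart_fderiv_chart_comp (riemannianNorm a) hφ
      (hγ.mdifferentiableAt (by simp) (x := s)) hs 1
    rw [fderiv_apply_one_eq_deriv] at h
    rw [h]
    exact fun h0 ↦ hv s ((riemannianNorm_eq_zero_iff a).1 h0)
  have hfst : (fun s : ℝ ↦ fderiv ℝ (fun v : E ↦ inChart (randersNorm a X) φ (φ (γ s)) v)
        (deriv (fun r ↦ φ (γ r)) s)) =ᶠ[𝓝 t]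
      (fun s : ℝ ↦ fderiv ℝ (fun v : E ↦ inChart (riemannianNorm a) φ (φ (γ s)) v)
        (deriv (fun r ↦ φ (γ r)) s) + formInChart a X φ (φ (γ s))) := by
    filter_upwards [hγ.continuous.continuousAt.preimage_mem_nhds
      (φ.open_source.mem_nhds ht)] with s hs
    simp only [inChart_randersNorm]
    rw [fderiv_fun_add (differentiableAt_inChart_riemannianNorm_right a (hne s hs))
      (by fun_prop), ContinuousLinearMap.fderiv]
  have hsnd : fderiv ℝ (fun x : E ↦ inChart (randersNorm a X) φ x (deriv (fun r ↦ φ (γ r)) t))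
        (φ (γ t)) =
      fderiv ℝ (fun x : E ↦ inChart (riemannianNorm a) φ x (deriv (fun r ↦ φ (γ r)) t))
        (φ (γ t)) +
      fderiv ℝ (fun x ↦ formInChart a X φ x (deriv (fun r ↦ φ (γ r)) t)) (φ (γ t)) := by
    simp only [inChart_randersNorm]
    have hmem := φ.map_source ht
    exact fderiv_fun_add (differentiableAt_inChart_riemannianNorm_left a hφ hmem (hne t ht))
      ((differentiableAt_formInChart a hX hφ hmem).clm_apply (differentiableAt_const _))
  rw [EulerLagrangeAt, EulerLagrangeAt, hfst.hasDerivAt_iff, hsnd]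
  constructor
  · intro h
    simpa [Pi.sub_def] using h.sub hform
  · intro h
    exact h.add hform

end Randers

section Homogeneous

variable {E' : Type*} [NormedAddCommGroup E'] [NormedSpace ℝ E']
  {G : Type*} [TopologicalSpace G] [ChartedSpace E' G] [Group G]

theorem IsOneParameterSubgroup.map_zero {Y : GroupLieAlgebra 𝓘(ℝ, E') G} {c : ℝ → G}
    (hc : IsOneParameterSubgroup Y c) : c 0 = 1 := by
  have h := hc.map_add 0 0
  rw [add_zero] at h
  exact left_eq_mul.1 h

section LieGroup

variable [LieGroup 𝓘(ℝ, E') ∞ G]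

theorem IsOneParameterSubgroup.mfderiv_mul {Y : GroupLieAlgebra 𝓘(ℝ, E') G} {c : ℝ → G}
    (hc : IsOneParameterSubgroup Y c) (g : G) :
    mfderiv 𝓘(ℝ, ℝ) 𝓘(ℝ, E') (fun s ↦ g * c s) 0 (1 : ℝ) = mulInvariantVectorField Y g := by
  have h := mfderiv_comp_apply_of_eq (I := 𝓘(ℝ, ℝ)) (I' := 𝓘(ℝ, E')) (I'' := 𝓘(ℝ, E'))
    (g := fun k : G ↦ g * k) (f := c) (0 : ℝ)
    ((contMDiff_mul_left (I := 𝓘(ℝ, E')) (n := ∞) (a := g)).mdifferentiableAt (by simp))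
    (hc.smooth.mdifferentiableAt (by simp)) hc.map_zero (1 : ℝ)
  refine h.trans ?_
  exact congrArg (mfderiv 𝓘(ℝ, E') 𝓘(ℝ, E') (fun k : G ↦ g * k) (1 : G)) hc.velocity_zero

theorem IsOneParameterSubgroup.velocity_eq {Y : GroupLieAlgebra 𝓘(ℝ, E') G} {c : ℝ → G}
    (hc : IsOneParameterSubgroup Y c) (t : ℝ) :
    velocity (E := E') c t = mulInvariantVectorField Y (c t) := by
  have hsm : ContMDiff 𝓘(ℝ, ℝ) 𝓘(ℝ, E') ∞ (fun s ↦ c t * c s) :=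
    contMDiff_const.mul hc.smooth
  have hct : c = (fun s ↦ c t * c s) ∘ (fun s ↦ s - t) := by
    ext s
    simp [← hc.map_add]
  have hd : HasDerivAt (fun s : ℝ ↦ s - t) 1 t := (hasDerivAt_id t).sub_const t
  have h := mfderiv_comp_apply_of_eq (I := 𝓘(ℝ, ℝ)) (I' := 𝓘(ℝ, ℝ)) (I'' := 𝓘(ℝ, E'))
    (g := fun s ↦ c t * c s) (f := fun s ↦ s - t) (y := 0) t
    (hsm.mdifferentiableAt (by simp)) hd.differentiableAt.mdifferentiableAt (by simp) (1 : ℝ)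
  rw [← hct] at h
  refine h.trans (Eq.trans ?_ (hc.mfderiv_mul (c t)))
  have h1 : mfderiv 𝓘(ℝ, ℝ) 𝓘(ℝ, ℝ) (fun s : ℝ ↦ s - t) t (1 : ℝ) = (1 : ℝ) := by
    rw [mfderiv_eq_fderiv]
    exact (fderiv_apply_one_eq_deriv (f := fun s : ℝ ↦ s - t)).trans hd.deriv
  exact congrArg (mfderiv 𝓘(ℝ, ℝ) 𝓘(ℝ, E') (fun s ↦ c t * c s) 0) h1

/-- The invariant vector field of `z` in the preferred chart at `g`. -/
noncomputable def invariantFieldInChart (z : GroupLieAlgebra 𝓘(ℝ, E') G) (g : G) : E' → E' :=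
  VectorField.mpullback 𝓘(ℝ, E') 𝓘(ℝ, E') (extChartAt 𝓘(ℝ, E') g).symm (mulInvariantVectorField z)

omit [LieGroup 𝓘(ℝ, E') ∞ G] [Group G] in
theorem contMDiffAt_extChartAt_symm [IsManifold 𝓘(ℝ, E') ∞ G] {g : G} {x : E'}
    (hx : x ∈ (extChartAt 𝓘(ℝ, E') g).target) :
    ContMDiffAt 𝓘(ℝ, E') 𝓘(ℝ, E') ∞ (extChartAt 𝓘(ℝ, E') g).symm x :=
  (contMDiffOn_extChartAt_symm g).contMDiffAt ((isOpen_extChartAt_target g).mem_nhds hx)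

theorem isInvertible_mfderiv_extChartAt_symm {g : G} {x : E'}
    (hx : x ∈ (extChartAt 𝓘(ℝ, E') g).target) :
    (mfderiv 𝓘(ℝ, E') 𝓘(ℝ, E') (extChartAt 𝓘(ℝ, E') g).symm x).IsInvertible := by
  have : IsManifold 𝓘(ℝ, E') 1 G := IsManifold.of_le (n := ∞) (by simp)
  simpa [mfderivWithin_univ] using isInvertible_mfderivWithin_extChartAt_symm hx

theorem mfderiv_extChartAt_symm_invariantFieldInChart (z : GroupLieAlgebra 𝓘(ℝ, E') G) {g : G}
    {x : E'} (hx : x ∈ (extChartAt 𝓘(ℝ, E') g).target) :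
    mfderiv 𝓘(ℝ, E') 𝓘(ℝ, E') (extChartAt 𝓘(ℝ, E') g).symm x
        (invariantFieldInChart (E' := E') z g x : E') =
      mulInvariantVectorField z ((extChartAt 𝓘(ℝ, E') g).symm x) := by
  have key : ∀ A : E' →L[ℝ] E', A.IsInvertible → ∀ v, A (A.inverse v) = v := by
    rintro _ ⟨e, rfl⟩ v
    simp
  exact key _ (isInvertible_mfderiv_extChartAt_symm hx) _

theorem differentiableAt_invariantFieldInChart
    (z : GroupLieAlgebra 𝓘(ℝ, E') G) {g : G} [CompleteSpace E']
    {x : E'} (hx : x ∈ (extChartAt 𝓘(ℝ, E') g).target) :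
    DifferentiableAt ℝ (invariantFieldInChart z g) x := by
  have : LieGroup 𝓘(ℝ, E') (minSmoothness ℝ 3) G :=
    LieGroup.of_le (n := ∞) (by simpa using ENat.LEInfty.out)
  have h := (contMDiffAt_mulInvariantVectorField z
    (g := (extChartAt 𝓘(ℝ, E') g).symm x)).of_le (m := 1) (by simp)
  have h' := h.mpullback_vectorField_preimage (n := ∞) (contMDiffAt_extChartAt_symm hx)
    (isInvertible_mfderiv_extChartAt_symm hx) (by decide)
  exact (contMDiffAt_vectorSpace_iff_contDiffAt.1 h').differentiableAt one_ne_zero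

theorem lieBracket_invariantFieldInChart
    (y z : GroupLieAlgebra 𝓘(ℝ, E') G) {g : G} [CompleteSpace E']
    {x : E'} (hx : x ∈ (extChartAt 𝓘(ℝ, E') g).target) :
    VectorField.lieBracket ℝ (invariantFieldInChart y g) (invariantFieldInChart z g) x =
      invariantFieldInChart ⁅y, z⁆ g x := by
  have : LieGroup 𝓘(ℝ, E') (minSmoothness ℝ 3) G :=
    LieGroup.of_le (n := ∞) (by simpa using ENat.LEInfty.out)
  have : IsManifold 𝓘(ℝ, E') (minSmoothness ℝ 3) G :=
    IsManifold.of_le (n := ∞) (by simpa using ENat.LEInfty.out)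
  have h := VectorField.mpullback_mlieBracket (n := ∞)
    (mdifferentiableAt_mulInvariantVectorField y (g := (extChartAt 𝓘(ℝ, E') g).symm x))
    (mdifferentiableAt_mulInvariantVectorField z (g := (extChartAt 𝓘(ℝ, E') g).symm x))
    (contMDiffAt_extChartAt_symm hx) (by simpa using ENat.LEInfty.out)
  rw [← mulInvariantVector_mlieBracket] at h
  refine (h.trans ?_).symm
  rw [← VectorField.mlieBracketWithin_univ, VectorField.mlieBracketWithin_eq_lieBracketWithin]
  exact congrFun VectorField.lieBracketWithin_univ x

end LieGroup

end Homogeneous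

section Submersion

variable {E E' : Type*} [NormedAddCommGroup E] [NormedSpace ℝ E]
  [NormedAddCommGroup E'] [NormedSpace ℝ E']
  {M N : Type*} [TopologicalSpace M] [ChartedSpace E' M] [TopologicalSpace N] [ChartedSpace E N]

theorem mfderiv_surjective_of_isSubmersionAt {f : M → N} {x : M}
    (hf : Manifold.IsSubmersionAt 𝓘(ℝ, E') 𝓘(ℝ, E) ∞ f x) :
    Function.Surjective (mfderiv 𝓘(ℝ, E') 𝓘(ℝ, E) f x) := by
  intro w
  have hd := mdifferentiable_of_mem_maximalAtlas hf.domChart_mem_maximalAtlas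
  have hc := mdifferentiable_of_mem_maximalAtlas hf.codChart_mem_maximalAtlas
  have hx := hf.mem_domChart_source
  have hfx := hf.mem_codChart_source
  have hfd : MDifferentiableAt 𝓘(ℝ, E') 𝓘(ℝ, E) f x := hf.contMDiffAt.mdifferentiableAt (by simp)
  let u : E := mfderiv 𝓘(ℝ, E) 𝓘(ℝ, E) hf.codChart (f x) w
  let e : E' := hf.equiv.symm (u, 0)
  have hloc : (fun z ↦ hf.codChart (f z)) =ᶠ[𝓝 x]
      fun z ↦ (hf.equiv (hf.domChart z)).1 := by
    filter_upwards [hf.domChart.open_source.mem_nhds hx] with z hz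
    have hz' : hf.domChart z ∈ (hf.domChart.extend 𝓘(ℝ, E')).target := by
      simpa using hf.domChart.map_source hz
    have h := hf.writtenInCharts hz'
    simpa [hz] using h
  obtain ⟨v, hv⟩ := hd.mfderiv_surjective hx e
  refine ⟨v, hc.mfderiv_injective hfx ?_⟩
  let L : E' →L[ℝ] E :=
    (ContinuousLinearMap.fst ℝ E hf.complement).comp (hf.equiv : E' →L[ℝ] E × hf.complement)
  have h1 := mfderiv_comp_apply (I := 𝓘(ℝ, E')) (I' := 𝓘(ℝ, E)) (I'' := 𝓘(ℝ, E)) x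
    (g := hf.codChart) (hc.mdifferentiableAt hfx) hfd v
  have h2 := mfderiv_comp_apply (I := 𝓘(ℝ, E')) (I' := 𝓘(ℝ, E')) (I'' := 𝓘(ℝ, E)) x
    (g := L) (f := hf.domChart) L.differentiableAt.mdifferentiableAt (hd.mdifferentiableAt hx) v
  have h3 : mfderiv 𝓘(ℝ, E') 𝓘(ℝ, E) (hf.codChart ∘ f) x =
      mfderiv 𝓘(ℝ, E') 𝓘(ℝ, E) (L ∘ hf.domChart) x := hloc.mfderiv_eq
  refine h1.symm.trans ((DFunLike.congr_fun h3 v).trans (h2.trans ?_))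
  refine (congrArg (mfderiv 𝓘(ℝ, E') 𝓘(ℝ, E) L (hf.domChart x)) hv).trans ?_
  rw [mfderiv_eq_fderiv, L.fderiv]
  have hLe : L e = u := by simp [L, e]
  exact hLe

/-- A submersion has a differentiable local section through each point. -/
theorem exists_local_section_of_isSubmersionAt {f : M → N} {x : M}
    (hf : Manifold.IsSubmersionAt 𝓘(ℝ, E') 𝓘(ℝ, E) ∞ f x) :
    ∃ s : N → M, MDifferentiableAt 𝓘(ℝ, E) 𝓘(ℝ, E') s (f x) ∧ s (f x) = x ∧
      ∀ᶠ q in 𝓝 (f x), f (s q) = q := by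
  have hd := mdifferentiable_of_mem_maximalAtlas hf.domChart_mem_maximalAtlas
  have hc := mdifferentiable_of_mem_maximalAtlas hf.codChart_mem_maximalAtlas
  have hx := hf.mem_domChart_source
  have hfx := hf.mem_codChart_source
  have hloc : ∀ u ∈ hf.domChart.target,
      hf.codChart (f (hf.domChart.symm u)) = (hf.equiv u).1 := by
    intro u hu
    have hu' : u ∈ (hf.domChart.extend 𝓘(ℝ, E')).target := by simpa using hu
    simpa using hf.writtenInCharts hu'
  let r : E → E' := fun w ↦ hf.equiv.symm (w, (hf.equiv (hf.domChart x)).2)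
  let σ : N → E' := fun q ↦ r (hf.codChart q)
  have hσx : σ (f x) = hf.domChart x := by
    have h := hloc _ (hf.domChart.map_source hx)
    rw [hf.domChart.left_inv hx] at h
    simp [σ, r, h]
  have hr : Differentiable ℝ r := by fun_prop
  have hσ : MDifferentiableAt 𝓘(ℝ, E) 𝓘(ℝ, E') σ (f x) :=
    hr.differentiableAt.mdifferentiableAt.comp (f x) (hc.mdifferentiableAt hfx)
  have hmem : σ (f x) ∈ hf.domChart.target := hσx ▸ hf.domChart.map_source hx
  have hs : MDifferentiableAt 𝓘(ℝ, E) 𝓘(ℝ, E') (fun q ↦ hf.domChart.symm (σ q)) (f x) :=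
    (hd.mdifferentiableAt_symm hmem).comp (f x) hσ
  have hsx : hf.domChart.symm (σ (f x)) = x := by rw [hσx, hf.domChart.left_inv hx]
  refine ⟨fun q ↦ hf.domChart.symm (σ q), hs, hsx, ?_⟩
  have hcont : ContinuousAt (fun q ↦ f (hf.domChart.symm (σ q))) (f x) :=
    ContinuousAt.comp_of_eq hf.contMDiffAt.continuousAt hs.continuousAt hsx
  filter_upwards [hf.codChart.open_source.mem_nhds hfx,
    hσ.continuousAt.preimage_mem_nhds (hf.domChart.open_target.mem_nhds hmem),
    hcont.preimage_mem_nhds (hf.codChart.open_source.mem_nhds (by rwa [hsx]))] with q hq hq' hq''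
  refine hf.codChart.injOn hq'' hq ?_
  rw [hloc _ hq']
  simp [σ, r]

end Submersion

section Invariance

variable {E' : Type*} [NormedAddCommGroup E'] [NormedSpace ℝ E']
  {G : Type*} [TopologicalSpace G] [ChartedSpace E' G] [Group G] {H : Subgroup G}
  {E : Type*} [NormedAddCommGroup E] [NormedSpace ℝ E]
  [ChartedSpace E (G ⧸ H)]

theorem IsHomogeneousManifold.contMDiff_mk (hM : IsHomogeneousManifold E' E H) :
    ContMDiff 𝓘(ℝ, E') 𝓘(ℝ, E) ∞ (QuotientGroup.mk : G → G ⧸ H) :=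
  Manifold.IsSubmersion.contMDiff hM

theorem IsHomogeneousManifold.mdifferentiableAt_smul_origin [LieGroup 𝓘(ℝ, E') ∞ G]
    (hM : IsHomogeneousManifold E' E H) (g : G) :
    MDifferentiableAt 𝓘(ℝ, E) 𝓘(ℝ, E) (fun q : G ⧸ H ↦ g • q) (origin H) := by
  obtain ⟨s, hs, -, hsec⟩ := exists_local_section_of_isSubmersionAt
    (Manifold.IsSubmersion.isSubmersionAt hM (1 : G))
  have hcomp : MDifferentiableAt 𝓘(ℝ, E) 𝓘(ℝ, E) (fun q : G ⧸ H ↦ ((g * s q : G) : G ⧸ H))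
      (origin H) :=
    ((hM.contMDiff_mk.comp (contMDiff_mul_left (I := 𝓘(ℝ, E')) (n := ∞) (a := g))).mdifferentiableAt
      (by simp)).comp (origin H) hs
  refine hcomp.congr_of_eventuallyEq ?_
  filter_upwards [hsec] with q hq
  conv_lhs => rw [← hq]
  rfl

/-- An invariant function on the tangent bundle of `G ⧸ H` pulls back to a left-invariant function
on the tangent bundle of `G`. -/
theorem IsInvariant.apply_mfderiv_mk [LieGroup 𝓘(ℝ, E') ∞ G]
    {F : (x : G ⧸ H) → TangentSpace 𝓘(ℝ, E) x → ℝ} (hF : IsInvariant H F)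
    (hM : IsHomogeneousManifold E' E H) (z : GroupLieAlgebra 𝓘(ℝ, E') G) (g : G) :
    F (QuotientGroup.mk g) (mfderiv 𝓘(ℝ, E') 𝓘(ℝ, E) (QuotientGroup.mk : G → G ⧸ H) g
      (mulInvariantVectorField z g)) = F (origin H) (projDeriv H z) := by
  have hmk := hM.contMDiff_mk
  have hg := hM.mdifferentiableAt_smul_origin g
  refine Eq.trans ?_ (hF g (origin H) (projDeriv H z))
  have h1 := mfderiv_comp_apply_of_eq (I := 𝓘(ℝ, E')) (I' := 𝓘(ℝ, E)) (I'' := 𝓘(ℝ, E))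
    (g := fun q : G ⧸ H ↦ g • q) (f := (QuotientGroup.mk : G → G ⧸ H)) (1 : G) hg
    (hmk.mdifferentiableAt (by simp)) rfl z
  have h2 := mfderiv_comp_apply_of_eq (I := 𝓘(ℝ, E')) (I' := 𝓘(ℝ, E')) (I'' := 𝓘(ℝ, E))
    (g := (QuotientGroup.mk : G → G ⧸ H)) (f := fun k : G ↦ g * k) (y := g) (1 : G)
    (hmk.mdifferentiableAt (by simp))
    ((contMDiff_mul_left (I := 𝓘(ℝ, E')) (n := ∞) (a := g)).mdifferentiableAt (by simp))
    (mul_one g) z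
  refine apply_congr_point F ?_ (h2.symm.trans h1)
  exact congrArg (QuotientGroup.mk : G → G ⧸ H) (mul_one g).symm

variable [IsManifold 𝓘(ℝ, E) ∞ (G ⧸ H)]
  {a : Bundle.ContMDiffRiemannianMetric 𝓘(ℝ, E) ∞ E (fun x : G ⧸ H ↦ TangentSpace 𝓘(ℝ, E) x)}
  {X : (x : G ⧸ H) → TangentSpace 𝓘(ℝ, E) x}

theorem randersNorm_add_randersNorm_neg (x : G ⧸ H) (v : TangentSpace 𝓘(ℝ, E) x) :
    randersNorm a X x v + randersNorm a X x (-v) = 2 * riemannianNorm a x v := by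
  simp [randersNorm, riemannianNorm]
  ring

theorem IsInvariant.riemannianNorm (hF : IsInvariant H (randersNorm a X)) :
    IsInvariant H (riemannianNorm a) := by
  intro g x v
  have h1 := hF g x v
  have h2 := hF g x (-v)
  rw [map_neg] at h2
  have h3 := randersNorm_add_randersNorm_neg (a := a) (X := X) x v
  rw [← h1, ← h2, randersNorm_add_randersNorm_neg] at h3
  linarith

theorem IsInvariant.form (hF : IsInvariant H (randersNorm a X)) :
    IsInvariant H (fun x v ↦ a.inner x (X x) v) := by
  intro g x v
  have h1 := hF g x v
  have h2 := hF.riemannianNorm g x v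
  simp only [randersNorm, HomogeneousRanders.riemannianNorm] at h1 h2 ⊢
  linarith

end Invariance

section Orbit

variable {E' : Type*} [NormedAddCommGroup E'] [NormedSpace ℝ E']
  {G : Type*} [TopologicalSpace G] [ChartedSpace E' G] [Group G] [LieGroup 𝓘(ℝ, E') ∞ G]
  {H : Subgroup G}
  {E : Type*} [NormedAddCommGroup E] [NormedSpace ℝ E] [ChartedSpace E (G ⧸ H)]

theorem velocity_mk_eq (hM : IsHomogeneousManifold E' E H) {y : GroupLieAlgebra 𝓘(ℝ, E') G}
    {c : ℝ → G} (hc : IsOneParameterSubgroup y c) (t : ℝ) :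
    velocity (E := E) (fun s ↦ (c s : G ⧸ H)) t =
      mfderiv 𝓘(ℝ, E') 𝓘(ℝ, E) (QuotientGroup.mk : G → G ⧸ H) (c t)
        (mulInvariantVectorField y (c t)) :=
  (mfderiv_comp_apply (I := 𝓘(ℝ, ℝ)) (I' := 𝓘(ℝ, E')) (I'' := 𝓘(ℝ, E)) t
    (g := (QuotientGroup.mk : G → G ⧸ H)) (f := c)
    (hM.contMDiff_mk.mdifferentiableAt (by simp)) (hc.smooth.mdifferentiableAt (by simp))
    (1 : ℝ)).trans (congrArg _ (hc.velocity_eq t))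

theorem mfderiv_mk_mulInvariantVectorField_eq_zero (hM : IsHomogeneousManifold E' E H)
    {y : GroupLieAlgebra 𝓘(ℝ, E') G} {c : ℝ → G} (hc : IsOneParameterSubgroup y c)
    (hcH : ∀ t, c t ∈ H) (g : G) :
    mfderiv 𝓘(ℝ, E') 𝓘(ℝ, E) (QuotientGroup.mk : G → G ⧸ H) g
      (mulInvariantVectorField y g) = 0 := by
  have h := mfderiv_comp_apply_of_eq (I := 𝓘(ℝ, ℝ)) (I' := 𝓘(ℝ, E')) (I'' := 𝓘(ℝ, E)) (0 : ℝ)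
    (g := (QuotientGroup.mk : G → G ⧸ H)) (f := fun s ↦ g * c s) (y := g)
    (hM.contMDiff_mk.mdifferentiableAt (by simp))
    (((contMDiff_const (n := ∞)).mul hc.smooth).mdifferentiableAt (by simp))
    (by simp [hc.map_zero]) (1 : ℝ)
  have hconst : (QuotientGroup.mk : G → G ⧸ H) ∘ (fun s ↦ g * c s) = fun _ ↦ (g : G ⧸ H) := by
    ext s
    simp [hcH s]
  rw [hconst, mfderiv_const] at h
  exact (h.trans (congrArg _ (hc.mfderiv_mul g))).symm

omit [LieGroup 𝓘(ℝ, E') ∞ G] in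
theorem mulInvariantVectorField_one (z : GroupLieAlgebra 𝓘(ℝ, E') G) :
    mulInvariantVectorField z (1 : G) = z := by
  have h : (fun k : G ↦ 1 * k) = id := by
    ext k
    simp
  rw [mulInvariantVectorField, h, mfderiv_id]
  rfl

theorem IsReductiveDecomposition.mfderiv_mk_eq_zero {m h : Submodule ℝ (GroupLieAlgebra 𝓘(ℝ, E') G)}
    (hd : IsReductiveDecomposition H m h) (hM : IsHomogeneousManifold E' E H)
    {z : GroupLieAlgebra 𝓘(ℝ, E') G} (hz : z ∈ h) (g : G) :
    mfderiv 𝓘(ℝ, E') 𝓘(ℝ, E) (QuotientGroup.mk : G → G ⧸ H) g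
      (mulInvariantVectorField z g) = 0 := by
  obtain ⟨c, hc, hcH⟩ := (hd.mem_h z).1 hz
  exact mfderiv_mk_mulInvariantVectorField_eq_zero hM hc hcH g

theorem IsReductiveDecomposition.projDeriv_projection
    {m h : Submodule ℝ (GroupLieAlgebra 𝓘(ℝ, E') G)}
    (hd : IsReductiveDecomposition H m h) (hM : IsHomogeneousManifold E' E H)
    (z : GroupLieAlgebra 𝓘(ℝ, E') G) :
    (projDeriv H (m.projection h hd.isCompl z) : TangentSpace 𝓘(ℝ, E) (origin H)) =
      projDeriv H z := by
  have hz : z - m.projection h hd.isCompl z ∈ h := by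
    have h1 := Submodule.projection_add_projection_eq_self hd.isCompl z
    rw [← eq_sub_iff_add_eq'] at h1
    rw [← h1]
    exact Submodule.coe_mem _
  have h0 := hd.mfderiv_mk_eq_zero (E := E) hM hz 1
  rw [mulInvariantVectorField_one] at h0
  have h2 : (projDeriv H (z - m.projection h hd.isCompl z) :
    TangentSpace 𝓘(ℝ, E) (origin H)) = 0 := h0
  rw [map_sub, sub_eq_zero] at h2
  exact h2.symm

theorem IsReductiveDecomposition.exists_mem_mfderiv_mk_eq
    {m h : Submodule ℝ (GroupLieAlgebra 𝓘(ℝ, E') G)}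
    (hd : IsReductiveDecomposition H m h) (hM : IsHomogeneousManifold E' E H) (g : G)
    (w : TangentSpace 𝓘(ℝ, E) (g : G ⧸ H)) :
    ∃ z ∈ m, mfderiv 𝓘(ℝ, E') 𝓘(ℝ, E) (QuotientGroup.mk : G → G ⧸ H) g
      (mulInvariantVectorField z g) = w := by
  obtain ⟨u, hu⟩ := mfderiv_surjective_of_isSubmersionAt
    (Manifold.IsSubmersion.isSubmersionAt hM g) w
  obtain ⟨z, hz⟩ : ∃ z : GroupLieAlgebra 𝓘(ℝ, E') G, mulInvariantVectorField z g = u := by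
    have h1 := mfderiv_comp_apply_of_eq (I := 𝓘(ℝ, E')) (I' := 𝓘(ℝ, E')) (I'' := 𝓘(ℝ, E'))
      (g := fun k : G ↦ g * k) (f := fun k : G ↦ g⁻¹ * k) (y := 1) g
      ((contMDiff_mul_left (I := 𝓘(ℝ, E')) (n := ∞) (a := g)).mdifferentiableAt (by simp))
      ((contMDiff_mul_left (I := 𝓘(ℝ, E')) (n := ∞) (a := g⁻¹)).mdifferentiableAt (by simp))
      (by simp) u
    have hid : (fun k : G ↦ g * k) ∘ (fun k : G ↦ g⁻¹ * k) = id := by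
      ext k
      simp
    rw [hid, mfderiv_id] at h1
    exact ⟨_, h1.symm⟩
  obtain ⟨x, hx, z', hz', rfl⟩ := Submodule.mem_sup.1
    (hd.isCompl.sup_eq_top ▸ Submodule.mem_top : z ∈ m ⊔ h)
  refine ⟨x, hx, ?_⟩
  rw [← hu, ← hz, mulInvariantVectorField_add, Pi.add_apply, map_add,
    hd.mfderiv_mk_eq_zero hM hz' g, add_zero]

variable [IsManifold 𝓘(ℝ, E) ∞ (G ⧸ H)]
  {a : Bundle.ContMDiffRiemannianMetric 𝓘(ℝ, E) ∞ E (fun x : G ⧸ H ↦ TangentSpace 𝓘(ℝ, E) x)}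
  {X : (x : G ⧸ H) → TangentSpace 𝓘(ℝ, E) x}

/-- The Euler-Lagrange equations of an invariant one-form `a(X, ·)` along the orbit of the origin
under the one-parameter subgroup of `y`, if the form vanishes on `[y, z]` for enough `z`. -/
theorem hasDerivAt_formInChart_orbit [FiniteDimensional ℝ E] [CompleteSpace E']
    (hM : IsHomogeneousManifold E' E H)
    (hX : ContMDiff 𝓘(ℝ, E) 𝓘(ℝ, E).tangent ∞
      (fun x : G ⧸ H ↦ (⟨x, X x⟩ : TangentBundle 𝓘(ℝ, E) (G ⧸ H))))
    {m : Set (GroupLieAlgebra 𝓘(ℝ, E') G)} {ℓ : GroupLieAlgebra 𝓘(ℝ, E') G → ℝ}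
    (hℓ : ∀ z (g : G), a.inner (g : G ⧸ H) (X g) (mfderiv 𝓘(ℝ, E') 𝓘(ℝ, E)
      (QuotientGroup.mk : G → G ⧸ H) g (mulInvariantVectorField z g)) = ℓ z)
    (hm : ∀ (g : G) (w : TangentSpace 𝓘(ℝ, E) (g : G ⧸ H)), ∃ z ∈ m,
      mfderiv 𝓘(ℝ, E') 𝓘(ℝ, E) (QuotientGroup.mk : G → G ⧸ H) g (mulInvariantVectorField z g) = w)
    {y : GroupLieAlgebra 𝓘(ℝ, E') G} (hy : ∀ z ∈ m, ℓ ⁅y, z⁆ = 0)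
    {c : ℝ → G} (hc : IsOneParameterSubgroup y c) {φ : OpenPartialHomeomorph (G ⧸ H) E}
    (hφ : φ ∈ IsManifold.maximalAtlas 𝓘(ℝ, E) ∞ (G ⧸ H)) {t : ℝ} (ht : (c t : G ⧸ H) ∈ φ.source) :
    HasDerivAt (fun s ↦ formInChart a X φ (φ (c s)))
      (fderiv ℝ (fun x ↦ formInChart a X φ x (deriv (fun r ↦ φ (c r)) t)) (φ (c t))) t := by
  set g := c t with hg
  have hmk := hM.contMDiff_mk
  set ψ := extChartAt 𝓘(ℝ, E') g
  let f : E' → G ⧸ H := fun x ↦ (ψ.symm x : G ⧸ H)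
  let P : E' → E := fun x ↦ φ (f x)
  let D : GroupLieAlgebra 𝓘(ℝ, E') G → G → E := fun z k ↦
    mfderiv 𝓘(ℝ, E) 𝓘(ℝ, E) φ (k : G ⧸ H) (mfderiv 𝓘(ℝ, E') 𝓘(ℝ, E)
      (QuotientGroup.mk : G → G ⧸ H) k (mulInvariantVectorField z k))
  have hψg : ψ.symm (ψ g) = g := extChartAt_to_inv g
  have hψt : ψ g ∈ ψ.target := mem_extChartAt_target g
  have hfsm : ∀ x ∈ ψ.target, ContMDiffAt 𝓘(ℝ, E') 𝓘(ℝ, E) ∞ f x := fun x hx ↦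
    hmk.contMDiffAt.comp x (contMDiffAt_extChartAt_symm hx)
  have hfs : f (ψ g) ∈ φ.source := by simpa only [f, hψg] using ht
  have hPg : P (ψ g) = φ g := by simp only [P, f, hψg]
  have hP : ContDiffAt ℝ 2 P (ψ g) := by
    have h : ContMDiffAt 𝓘(ℝ, E') 𝓘(ℝ, E) ∞ P (ψ g) :=
      (contMDiffAt_of_mem_maximalAtlas hφ hfs).comp (ψ g) (hfsm _ hψt)
    exact h.contDiffAt.of_le ENat.LEInfty.out
  have hfV : ∀ z, ∀ x ∈ ψ.target,
      mfderiv 𝓘(ℝ, E') 𝓘(ℝ, E) f x (invariantFieldInChart (E' := E') z g x : E') =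
        mfderiv 𝓘(ℝ, E') 𝓘(ℝ, E) (QuotientGroup.mk : G → G ⧸ H) (ψ.symm x)
          (mulInvariantVectorField z (ψ.symm x)) := fun z x hx ↦
    (mfderiv_comp_apply (I := 𝓘(ℝ, E')) (I' := 𝓘(ℝ, E')) (I'' := 𝓘(ℝ, E)) x
      (g := (QuotientGroup.mk : G → G ⧸ H)) (f := ψ.symm) (hmk.mdifferentiableAt (by simp))
      ((contMDiffAt_extChartAt_symm hx).mdifferentiableAt (by simp)) _).trans
      (congrArg _ (mfderiv_extChartAt_symm_invariantFieldInChart z hx))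
  have hPV : ∀ z, fderiv ℝ P (ψ g) (invariantFieldInChart z g (ψ g)) = D z g := by
    intro z
    have h := fderiv_chart_comp hφ ((hfsm _ hψt).mdifferentiableAt (by simp)) hfs
      (invariantFieldInChart z g (ψ g))
    refine h.trans ((congrArg _ (hfV z _ hψt)).trans ?_)
    exact congrArg (D z) hψg
  have hform : ∀ z, ∀ x ∈ ψ.target, f x ∈ φ.source →
      formInChart a X φ (P x) (fderiv ℝ P x (invariantFieldInChart z g x)) = ℓ z := by
    intro z x hx hx'
    have h := inChart_fderiv_chart_comp (fun q v ↦ a.inner q (X q) v) hφ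
      ((hfsm x hx).mdifferentiableAt (by simp)) hx' (invariantFieldInChart z g x)
    exact h.trans ((congrArg _ (hfV z x hx)).trans (hℓ z _))
  have hev : ∀ z, ∀ᶠ x in 𝓝 (ψ g),
      formInChart a X φ (P x) (fderiv ℝ P x (invariantFieldInChart z g x)) = ℓ z := by
    intro z
    filter_upwards [(isOpen_extChartAt_target g).mem_nhds hψt,
      (hfsm _ hψt).continuousAt.preimage_mem_nhds (φ.open_source.mem_nhds hfs)] with x hx hx'
    exact hform z x hx hx'
  have hB : DifferentiableAt ℝ (formInChart a X φ) (φ g) :=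
    differentiableAt_formInChart a hX hφ (φ.map_source ht)
  have hsymm : ∀ v, fderiv ℝ (formInChart a X φ) (φ g) (D y g) v =
      fderiv ℝ (formInChart a X φ) (φ g) v (D y g) := by
    intro v
    obtain ⟨w, hw⟩ := (mdifferentiable_of_mem_maximalAtlas hφ).mfderiv_surjective ht v
    obtain ⟨z, hz, rfl⟩ := hm g w
    have h := fderiv_apply_sub_fderiv_apply (by rwa [hPg]) hP
      (differentiableAt_invariantFieldInChart y hψt)
      (differentiableAt_invariantFieldInChart z hψt) (hev y) (hev z)
    rw [lieBracket_invariantFieldInChart y z hψt, hform _ _ hψt hfs, hy z hz, hPV, hPV, hPg,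
      neg_zero, sub_eq_zero] at h
    rw [← hw]
    exact h
  have hcd : MDifferentiableAt 𝓘(ℝ, ℝ) 𝓘(ℝ, E) (fun s ↦ (c s : G ⧸ H)) t :=
    (hmk.comp hc.smooth).mdifferentiableAt (by simp)
  have hderiv : deriv (fun r ↦ φ (c r)) t = D y g := by
    rw [← fderiv_apply_one_eq_deriv]
    exact (fderiv_chart_comp hφ hcd ht 1).trans (congrArg _ (velocity_mk_eq hM hc t))
  have hdiff : DifferentiableAt ℝ (fun r ↦ φ (c r)) t :=
    (((mdifferentiable_of_mem_maximalAtlas hφ).mdifferentiableAt ht).comp t hcd).differentiableAt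
  have hmain := hB.hasFDerivAt.comp_hasDerivAt t hdiff.hasDerivAt
  rw [hderiv] at hmain ⊢
  have hlin : fderiv ℝ (fun x ↦ formInChart a X φ x (D y g)) (φ g) =
      fderiv ℝ (formInChart a X φ) (φ g) (D y g) := by
    ext v
    rw [hsymm, fderiv_clm_apply hB (by fun_prop)]
    simp
  rw [hlin]
  exact hmain

/-- For a `G`-invariant Randers function `√a(v, v) + a(X, v)` such that `a(X, ·)` vanishes on
`[y, m]`, the geodesic vectors in the direction `y` are those of the Riemannian metric `a`. -/
theorem isGeodesicVector_randersNorm_iff [FiniteDimensional ℝ E] [FiniteDimensional ℝ E']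
    (hM : IsHomogeneousManifold E' E H)
    (hX : ContMDiff 𝓘(ℝ, E) 𝓘(ℝ, E).tangent ∞
      (fun x : G ⧸ H ↦ (⟨x, X x⟩ : TangentBundle 𝓘(ℝ, E) (G ⧸ H))))
    (hF : IsInvariant H (randersNorm a X))
    {m h : Submodule ℝ (GroupLieAlgebra 𝓘(ℝ, E') G)} (hd : IsReductiveDecomposition H m h)
    {y : GroupLieAlgebra 𝓘(ℝ, E') G}
    (hy : ∀ z ∈ m, a.inner (origin H) (X (origin H))
      (projDeriv H (m.projection h hd.isCompl ⁅y, z⁆)) = 0) :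
    IsGeodesicVector H (randersNorm a X) y ↔ IsGeodesicVector H (riemannianNorm a) y := by
  have : CompleteSpace E' := FiniteDimensional.complete ℝ E'
  have hα := hF.riemannianNorm
  have hαval := fun z g ↦ hα.apply_mfderiv_mk hM z g
  have hβval := fun z g ↦ hF.form.apply_mfderiv_mk hM z g
  have hFval := fun z g ↦ hF.apply_mfderiv_mk hM z g
  unfold IsGeodesicVector
  refine and_congr_right fun _ ↦ exists_congr fun c ↦ and_congr_right fun hc ↦ ?_
  have hγ : (fun t : ℝ ↦ c t • origin H) = fun t ↦ (c t : G ⧸ H) := by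
    ext t
    exact congrArg (QuotientGroup.mk : G → G ⧸ H) (mul_one (c t))
  rw [hγ]
  have hsm : ContMDiff 𝓘(ℝ, ℝ) 𝓘(ℝ, E) ∞ (fun t ↦ (c t : G ⧸ H)) := hM.contMDiff_mk.comp hc.smooth
  have hne : ∀ t, velocity (E := E) (fun t ↦ (c t : G ⧸ H)) t ≠ 0 →
      ∀ s, velocity (E := E) (fun t ↦ (c t : G ⧸ H)) s ≠ 0 := by
    intro t ht s hs
    rw [velocity_mk_eq hM hc, ← riemannianNorm_eq_zero_iff a, hαval] at hs
    rw [velocity_mk_eq hM hc, Ne, ← riemannianNorm_eq_zero_iff a, hαval] at ht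
    exact ht hs
  have hEL : ∀ t, velocity (E := E) (fun t ↦ (c t : G ⧸ H)) t ≠ 0 →
      ∀ φ ∈ IsManifold.maximalAtlas 𝓘(ℝ, E) ∞ (G ⧸ H), (c t : G ⧸ H) ∈ φ.source →
      (EulerLagrangeAt (randersNorm a X) φ (fun t ↦ (c t : G ⧸ H)) t ↔
        EulerLagrangeAt (riemannianNorm a) φ (fun t ↦ (c t : G ⧸ H)) t) := by
    intro t ht φ hφ htφ
    refine eulerLagrangeAt_randersNorm_iff a hX hφ hsm (hne t ht) htφ
      (hasDerivAt_formInChart_orbit hM hX hβval (m := (m : Set (GroupLieAlgebra 𝓘(ℝ, E') G)))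
        (hd.exists_mem_mfderiv_mk_eq hM) ?_ hc hφ htφ)
    intro z hz
    have h0 := hy z hz
    rwa [hd.projDeriv_projection hM] at h0
  constructor
  · intro h
    refine ⟨hsm, ⟨riemannianNorm a (origin H) (projDeriv H y), fun t ↦ ?_⟩, fun t ht φ hφ htφ ↦
      (hEL t ht φ hφ htφ).1 (h.euler_lagrange t ht φ hφ htφ)⟩
    rw [velocity_mk_eq hM hc, hαval]
  · intro h
    refine ⟨hsm, ⟨randersNorm a X (origin H) (projDeriv H y), fun t ↦ ?_⟩, fun t ht φ hφ htφ ↦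
      (hEL t ht φ hφ htφ).2 (h.euler_lagrange t ht φ hφ htφ)⟩
    rw [velocity_mk_eq hM hc, hFval]

end Orbit

end HomogeneousRanders

theorem theorem4p2
    {E' : Type*} [NormedAddCommGroup E'] [NormedSpace ℝ E'] [FiniteDimensional ℝ E']
    {G : Type*} [TopologicalSpace G] [ChartedSpace E' G] [Group G] [LieGroup 𝓘(ℝ, E') ∞ G]
    [T2Space G]
    (H : Subgroup G) (_hH : IsClosed (H : Set G))
    {E : Type*} [NormedAddCommGroup E] [NormedSpace ℝ E] [FiniteDimensional ℝ E]
    [ChartedSpace E (G ⧸ H)] [IsManifold 𝓘(ℝ, E) ∞ (G ⧸ H)]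
    (_hM : HomogeneousRanders.IsHomogeneousManifold E' E H)
    (a : Bundle.ContMDiffRiemannianMetric 𝓘(ℝ, E) ∞ E
      (fun x : G ⧸ H ↦ TangentSpace 𝓘(ℝ, E) x))
    (X : (x : G ⧸ H) → TangentSpace 𝓘(ℝ, E) x)
    (_hX : ContMDiff 𝓘(ℝ, E) 𝓘(ℝ, E).tangent ∞
      (fun x : G ⧸ H ↦ (⟨x, X x⟩ : TangentBundle 𝓘(ℝ, E) (G ⧸ H))))
    (_hX1 : ∀ x : G ⧸ H, a.inner x (X x) (X x) < 1)
    (_hF : HomogeneousRanders.IsInvariant H (HomogeneousRanders.randersNorm a X))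
    (m h : Submodule ℝ (GroupLieAlgebra 𝓘(ℝ, E') G))
    (hd : HomogeneousRanders.IsReductiveDecomposition H m h)
    (y : GroupLieAlgebra 𝓘(ℝ, E') G)
    (_hy : ∀ z ∈ m,
      a.inner (HomogeneousRanders.origin H) (X (HomogeneousRanders.origin H))
        (HomogeneousRanders.projDeriv H (m.projection h hd.isCompl ⁅y, z⁆)) = 0) :
    HomogeneousRanders.IsGeodesicVector H (HomogeneousRanders.randersNorm a X) y ↔
      HomogeneousRanders.IsGeodesicVector H (HomogeneousRanders.riemannianNorm a) y := by
  exact HomogeneousRanders.isGeodesicVector_randersNorm_iff _hM _hX _hF hd _hy
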